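/- Let $X\subseteq\mathbb R^n$ be open, $U\subseteq\mathbb R^m$, let $f:X\to\mathbb R^n$, $g:X\to\mathbb R^{n\times m}$ be locally Lipschitz, and let $h,h_b:X\to\mathbb R$ be continuously differentiable and Lipschitz with constants $\mathcal L_h,\mathcal L_{h_b}$. Put $\mathcal C_S=\{x\in X: h(x)\ge 0\}$. Let $T>0$, let $u_b:X\to U$ be a backup controller whose closed-loop field $f_{cl}(x)=f(x)+g(x)u_b(x)$ is $C^1$, and suppose that its (nominal) flow $\phi_b^n:[0,T]\times X\to X$, $\dot\phi_b^n(\tau,x)=f_{cl}(\phi_b^n(\tau,x))$, $\phi_b^n(0,x)=x$, exists. Write $\Phi_b^n(\tau,x)=\partial\phi_b^n(\tau,x)/\partial x$. Let $\xi>0$, let $d_x:[0,\infty)\to\mathbb R^n$ be piecewise continuous with $\|d_x(t)\|\le\xi$ for all $t$, and suppose that the disturbed backup flow $\phi_b^d:[0,T]\times X\to X$, $\dot\phi_b^d(\tau,x)=f_{cl}(\phi_b^d(\tau,x))+d_x(\tau)$, $\phi_b^d(0,x)=x$, exists. Let $\delta_{\max}:[0,T]\to[0,\infty)$ satisfy $\|\phi_b^n(\tau,x)-\phi_b^d(\tau,x)\|\le\delta_{\max}(\tau)$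 for all $x\in\mathcal C_S$, $\tau\in[0,T]$, let $\tau\mapsto\epsilon_\tau$ be continuous on $[0,T]$ with $\epsilon_\tau\ge\mathcal L_h\delta_{\max}(\tau)$, and let $\epsilon_b\ge\mathcal L_{h_b}\delta_{\max}(T)$. Define $$\mathcal C_I=\{x\in X: h(\phi_b^n(\tau,x))\ge\epsilon_\tau\ \forall\tau\in[0,T],\ h_b(\phi_b^n(T,x))\ge\epsilon_b\},$$ $$\mathcal C_D=\{x\in X: h(\phi_b^d(\tau,x))\ge 0\ \forall\tau\in[0,T],\ h_b(\phi_b^d(T,x))\ge 0\}.$$ Assume that the functions defining $\mathcal C_I$ have nonzero gradient where they are active on its boundary: for $x\in\mathcal C_I\cap\partial\mathcal C_I$, $\nabla h(\phi_b^n(\tau,x))\Phi_b^n(\tau,x)\neq 0$ whenever $\tau\in[0,T]$ and $h(\phi_b^n(\tau,x))=\epsilon_\tau$, and $\nabla h_b(\phi_b^n(T,x))\Phi_b^n(T,x)\ne0$ whenever $h_b(\phi_b^n(T,x))=\epsilon_b$. Let $\alpha,\alpha_b:[0,\infty)\to[0,\infty)$ be class-$\mathcal K_\infty$ functions (only continuity,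 vanishing at $0$ and divergence to $\infty$ at $\infty$ are required), and let $u:X\to U$ be a locally Lipschitz feedback controller such that for every $x\in\mathcal C_I$ and every $\tau\in[0,T]$ $$\nabla h(\phi_b^n(\tau,x))\Phi_b^n(\tau,x)\big(f(x)+g(x)u(x)\big)-\xi\,\|\nabla h(\phi_b^n(\tau,x))\Phi_b^n(\tau,x)\|\ \ge\ -\alpha\big(h(\phi_b^n(\tau,x))-\epsilon_\tau\big),$$ $$\nabla h_b(\phi_b^n(T,x))\Phi_b^n(T,x)\big(f(x)+g(x)u(x)\big)-\xi\,\|\nabla h_b(\phi_b^n(T,x))\Phi_b^n(T,x)\|\ \ge\ -\alpha_b\big(h_b(\phi_b^n(T,x))-\epsilon_b\big).$$ Then $\mathcal C_I$ is forward invariant for the disturbed system $\dot x=f(x)+g(x)u(x)+d_x(t)$ in $X$: every solution with $x(0)\in\mathcal C_I$ satisfies $x(t)\in\mathcal C_I$ for as long as it exists. Moreover $\mathcal C_I\subseteq\mathcal C_D\subseteq\mathcal C_S$; in particular every such solution stays in $\mathcal C_S$. -/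

import Mathlib

open Set Filter Topology

noncomputable section

/-- State and input spaces: `ℝⁿ` and `ℝᵐ` with the Euclidean norm. -/
abbrev Euc (n : ℕ) := EuclideanSpace ℝ (Fin n)

/-- A function `α` on `[0, ∞)` with values in `[0, ∞)` that is continuous, vanishes at `0` and tends
to infinity at infinity. Every class-`𝒦∞` function in the usual sense is one; monotonicity is not
asked for. Only the values of `α` on `[0, ∞)` matter. -/
def IsClassKInf (α : ℝ → ℝ) : Prop :=
  ContinuousOn α (Ici 0) ∧ (∀ r, 0 ≤ r → 0 ≤ α r) ∧ α 0 = 0 ∧ Tendsto α atTop atTop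

/-- Piecewise continuity on `[0, ∞)`: on each bounded interval there are finitely many points of
discontinuity, and all one-sided limits exist. -/
def IsPiecewiseContinuous {n : ℕ} (d : ℝ → Euc n) : Prop :=
  ∀ S : ℝ, ∃ D : Set ℝ, D.Finite ∧
    (∀ t ∈ Icc 0 S \ D, ContinuousWithinAt d (Ici 0) t) ∧
    (∀ t ∈ Icc 0 S, (∃ l, Tendsto d (𝓝[>] t) (𝓝 l)) ∧ (0 < t → ∃ l, Tendsto d (𝓝[<] t) (𝓝 l)))

/-- Admissible disturbances: piecewise continuous in time, bounded in norm by `ξ`. -/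
def IsDisturbance {n : ℕ} (ξ : ℝ) (d : ℝ → Euc n) : Prop :=
  IsPiecewiseContinuous d ∧ ∀ t, 0 ≤ t → ‖d t‖ ≤ ξ

/-- `x` solves `x' = F t x` in `X` on `[0, S]`: it is continuous, stays in `X`, and satisfies the
equation at all but finitely many times (the jump times of the right-hand side). -/
def IsSolution {n : ℕ} (X : Set (Euc n)) (F : ℝ → Euc n → Euc n) (S : ℝ) (x : ℝ → Euc n) : Prop :=
  ContinuousOn x (Icc 0 S) ∧ (∀ t ∈ Icc 0 S, x t ∈ X) ∧
    ∃ D : Set ℝ, D.Finite ∧ ∀ t ∈ Icc 0 S \ D, HasDerivWithinAt x (F t (x t)) (Icc 0 S) t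

/-- `C` is forward invariant along `x' = F t x`: a solution that starts in `C` at time `0` remains
in `C` as long as it exists. -/
def IsForwardInvariantAlong {n : ℕ} (X : Set (Euc n)) (F : ℝ → Euc n → Euc n) (C : Set (Euc n)) : Prop :=
  ∀ S : ℝ, 0 < S → ∀ x : ℝ → Euc n, IsSolution X F S x → x 0 ∈ C → ∀ t ∈ Icc 0 S, x t ∈ C

/-- The control affine field closed by a feedback `k`: `f(x) + g(x) k(x)`. -/
def closedLoop {n m : ℕ} (f : Euc n → Euc n) (g : Euc n → (Euc m →L[ℝ] Euc n))
    (k : Euc n → Euc m) (x : Euc n) : Euc n :=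
  f x + g x (k x)

/-- The disturbed field `F(x) + d(t)`. -/
def disturbed {n : ℕ} (F : Euc n → Euc n) (d : ℝ → Euc n) (t : ℝ) (x : Euc n) : Euc n :=
  F x + d t

/-- `φ : [0, T] × X → X` is the flow of the autonomous field `F`. -/
def IsNominalFlow {n : ℕ} (X : Set (Euc n)) (F : Euc n → Euc n) (T : ℝ)
    (φ : ℝ → Euc n → Euc n) : Prop :=
  ∀ x ∈ X, φ 0 x = x ∧ ∀ τ ∈ Icc 0 T, φ τ x ∈ X ∧
    HasDerivWithinAt (fun s => φ s x) (F (φ τ x)) (Icc 0 T) τ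

/-- `φ : [0, T] × X → X` is the flow, started at time `0`, of `F` disturbed by `d`. -/
def IsDisturbedFlow {n : ℕ} (X : Set (Euc n)) (F : Euc n → Euc n) (d : ℝ → Euc n) (T : ℝ)
    (φ : ℝ → Euc n → Euc n) : Prop :=
  ∀ x ∈ X, φ 0 x = x ∧ IsSolution X (disturbed F d) T (fun τ => φ τ x)

/-- Sensitivity (state-transition) matrix `Φ(τ, x) = ∂φ(τ, x)/∂x`. -/
def sensitivity {n : ℕ} (φ : ℝ → Euc n → Euc n) (τ : ℝ) (x : Euc n) : Euc n →L[ℝ] Euc n :=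
  fderiv ℝ (φ τ) x

/-- The row vector `∇h(φ(τ, x)) Φ(τ, x)`, as a linear form; its operator norm is the Euclidean
norm of the row vector. -/
def gradAlong {n : ℕ} (h : Euc n → ℝ) (φ : ℝ → Euc n → Euc n) (τ : ℝ) (x : Euc n) :
    Euc n →L[ℝ] ℝ :=
  (fderiv ℝ h (φ τ x)).comp (sensitivity φ τ x)

/-- The safe set `{x ∈ X | h(x) ≥ 0}`. -/
def safeSet {n : ℕ} (X : Set (Euc n)) (h : Euc n → ℝ) : Set (Euc n) :=
  {x | x ∈ X ∧ 0 ≤ h x}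

/-- States in `X` whose flow satisfies `h ≥ ε τ` for all `τ ∈ [0, T]` and `hb ≥ εb` at `T`. With the
nominal backup flow this is `C_I`. -/
def tightenedSet {n : ℕ} (X : Set (Euc n)) (h hb : Euc n → ℝ) (T : ℝ) (ε : ℝ → ℝ) (εb : ℝ)
    (φ : ℝ → Euc n → Euc n) : Set (Euc n) :=
  {x | x ∈ X ∧ (∀ τ ∈ Icc 0 T, ε τ ≤ h (φ τ x)) ∧ εb ≤ hb (φ T x)}

/-- The set `C_D`: no tightening, and the flow is the disturbed backup flow. -/
def disturbedSet {n : ℕ} (X : Set (Euc n)) (h hb : Euc n → ℝ) (T : ℝ)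
    (φ : ℝ → Euc n → Euc n) : Set (Euc n) :=
  {x | x ∈ X ∧ (∀ τ ∈ Icc 0 T, 0 ≤ h (φ τ x)) ∧ 0 ≤ hb (φ T x)}

end

/-! The set `C_I` is cut out by the compact family of constraints `H_τ(y) = h(φ(τ,y)) - ε_τ`, `τ ∈
[0,T]`, together with one terminal constraint. Where a constraint is active, `α 0 = 0` turns the
controller condition into `∇H·F ≥ ξ‖∇H‖`, so `∇H·(F + d) ≥ 0` for every admissible disturbance:
Nagumo's condition, but without strictness.

Strictness comes from the gradient hypothesis. At a boundary point `x(a)` the single vector `v =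
F(x(a))` satisfies `∇H·v ≥ ξ‖∇H‖ > 0` for all active constraints at once. The shifted curve `x(t) +
η exp(κ(t - a)) v` is then strictly feasible at `t = a`, and for large `κ` the growth of the shift
outweighs the Lipschitz error of `F`, so no constraint can reach zero along it. Letting `η → 0`
gives feasibility of `x` on a short interval (`exists_forall_nonneg_of_robust_constraints`), and a
continuation argument covers the whole interval.

This needs `H` and `∇H` jointly continuous in `(τ, y)`, hence a flow that is `C¹` in the initial
state; `IsNominalFlow.hasFDerivAt` and `IsNominalFlow.continuousOn_sensitivity` derive this from the
variational equation and Grönwall's inequality. The inclusions follow from the Lipschitz bounds and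
from evaluation at `τ = 0`. -/

/-! ### Global solvability of linear differential equations. -/

section LinearODE

variable {E : Type*} [NormedAddCommGroup E] [NormedSpace ℝ E]

/-- Retraction of a normed space onto the closed ball of radius `R` about the origin. -/
noncomputable def radialTruncation (R : ℝ) (y : E) : E := (R / max R ‖y‖) • y

theorem radialTruncation_eq_self {R : ℝ} (hR : 0 < R) {y : E} (hy : ‖y‖ ≤ R) :
    radialTruncation R y = y := by
  rw [radialTruncation, max_eq_left hy, div_self hR.ne', one_smul]

theorem norm_radialTruncation_le_norm {R : ℝ} (hR : 0 < R) (y : E) :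
    ‖radialTruncation R y‖ ≤ ‖y‖ := by
  have hm : 0 < max R ‖y‖ := lt_max_of_lt_left hR
  rw [radialTruncation, norm_smul, Real.norm_of_nonneg (by positivity)]
  exact mul_le_of_le_one_left (norm_nonneg _) ((div_le_one hm).2 (le_max_left _ _))

theorem norm_radialTruncation_le {R : ℝ} (hR : 0 < R) (y : E) : ‖radialTruncation R y‖ ≤ R := by
  have hm : 0 < max R ‖y‖ := lt_max_of_lt_left hR
  rw [radialTruncation, norm_smul, Real.norm_of_nonneg (by positivity), div_mul_eq_mul_div,
    div_le_iff₀ hm]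
  exact mul_le_mul_of_nonneg_left (le_max_right _ _) hR.le

/-- The difference splits into a rescaled `y - z` and a change of scale acting on `z`; each
contributes at most `‖y - z‖`, whence the factor 2. -/
theorem norm_radialTruncation_sub_le {R : ℝ} (hR : 0 < R) (y z : E) :
    ‖radialTruncation R y - radialTruncation R z‖ ≤ 2 * ‖y - z‖ := by
  have hy : 0 < max R ‖y‖ := lt_max_of_lt_left hR
  have hz : 0 < max R ‖z‖ := lt_max_of_lt_left hR
  have key : radialTruncation R y - radialTruncation R z
      = (R / max R ‖y‖) • (y - z) + (R / max R ‖y‖ - R / max R ‖z‖) • z := by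
    simp only [radialTruncation, smul_sub, sub_smul]; abel
  have h1 : ‖(R / max R ‖y‖) • (y - z)‖ ≤ ‖y - z‖ := by
    rw [norm_smul, Real.norm_of_nonneg (by positivity)]
    exact mul_le_of_le_one_left (norm_nonneg _) ((div_le_one hy).2 (le_max_left _ _))
  have hmax : |max R ‖z‖ - max R ‖y‖| ≤ ‖y - z‖ := by
    refine (abs_max_sub_max_le_max _ _ _ _).trans ?_
    rw [sub_self, abs_zero, max_eq_right (abs_nonneg _), ← norm_neg (y - z), neg_sub]
    exact abs_norm_sub_norm_le _ _
  have h2 : ‖(R / max R ‖y‖ - R / max R ‖z‖) • z‖ ≤ ‖y - z‖ := by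
    have e : R / max R ‖y‖ - R / max R ‖z‖
        = (R / max R ‖y‖) * ((max R ‖z‖ - max R ‖y‖) / max R ‖z‖) := by
      field_simp
    rw [e, norm_smul, norm_mul, Real.norm_of_nonneg (show 0 ≤ R / max R ‖y‖ by positivity), norm_div,
      Real.norm_of_nonneg hz.le, Real.norm_eq_abs]
    have a1 : R / max R ‖y‖ ≤ 1 := (div_le_one hy).2 (le_max_left _ _)
    have a2 : ‖z‖ / max R ‖z‖ ≤ 1 := (div_le_one hz).2 (le_max_right _ _)
    calc R / max R ‖y‖ * (|max R ‖z‖ - max R ‖y‖| / max R ‖z‖) * ‖z‖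
        = (R / max R ‖y‖) * (‖z‖ / max R ‖z‖) * |max R ‖z‖ - max R ‖y‖| := by ring
      _ ≤ 1 * 1 * ‖y - z‖ := by gcongr
      _ = ‖y - z‖ := by ring
  rw [key, two_mul]
  exact (norm_add_le _ _).trans (add_le_add h1 h2)

/-- A form of Grönwall's inequality with a bound that is uniform on the interval. -/
theorem norm_le_mul_exp_of_norm_deriv_le {T : ℝ} {y y' : ℝ → E} {a K e : ℝ} (ha : 0 ≤ a) (hK : 0 ≤ K)
    (he : 0 ≤ e) (hy : ∀ t ∈ Icc 0 T, HasDerivWithinAt y (y' t) (Icc 0 T) t) (h0 : ‖y 0‖ ≤ a)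
    (hb : ∀ t ∈ Icc 0 T, ‖y' t‖ ≤ K * ‖y t‖ + e) :
    ∀ t ∈ Icc 0 T, ‖y t‖ ≤ (a + e) * Real.exp ((K + 1) * T) := by
  intro t ht
  have hK1 : 0 < K + 1 := by linarith
  -- The rate `K + 1` is nonzero even for `K = 0`, so `gronwallBound` has its exponential form, and
  -- `e / (K + 1) ≤ e`.
  have h := norm_le_gronwallBound_of_norm_deriv_right_le (K := K + 1) (ε := e)
    (fun s hs => (hy s hs).continuousWithinAt)
    (fun s hs => (hy s (Ico_subset_Icc_self hs)).mono_of_mem_nhdsWithin (Icc_mem_nhdsGE_of_mem hs))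
    h0 (fun s hs => (hb s (Ico_subset_Icc_self hs)).trans (by nlinarith [norm_nonneg (y s)])) t ht
  refine h.trans ?_
  rw [gronwallBound_of_K_ne_0 hK1.ne', sub_zero]
  have e1 : Real.exp ((K + 1) * t) ≤ Real.exp ((K + 1) * T) :=
    Real.exp_le_exp.2 (mul_le_mul_of_nonneg_left ht.2 hK1.le)
  have e2 : e / (K + 1) ≤ e := div_le_self he (by linarith)
  have e3 : 0 ≤ e / (K + 1) := by positivity
  have e4 : 1 ≤ Real.exp ((K + 1) * t) := Real.one_le_exp (mul_nonneg hK1.le ht.1)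
  have e5 : a * Real.exp ((K + 1) * t) ≤ a * Real.exp ((K + 1) * T) :=
    mul_le_mul_of_nonneg_left e1 ha
  have e6 : e / (K + 1) * (Real.exp ((K + 1) * t) - 1) ≤ e * Real.exp ((K + 1) * T) :=
    mul_le_mul e2 (by linarith) (by linarith) he
  rw [add_mul]
  exact add_le_add e5 e6

/-- A linear differential equation with continuous coefficients has solutions on the whole
interval. -/
theorem exists_hasDerivWithinAt_linear [CompleteSpace E] {T : ℝ} (hT : 0 ≤ T) {A : ℝ → E →L[ℝ] E}
    (hA : ContinuousOn A (Icc 0 T)) (x₀ : E) :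
    ∃ y : ℝ → E, y 0 = x₀ ∧ ∀ t ∈ Icc 0 T, HasDerivWithinAt y (A t (y t)) (Icc 0 T) t := by
  obtain ⟨L, hL⟩ := isCompact_Icc.exists_bound_of_continuousOn hA
  have hL0 : 0 ≤ L := (norm_nonneg _).trans (hL 0 ⟨le_rfl, hT⟩)
  -- `R` is the a priori Grönwall bound with forcing 1. The truncated field is bounded by `L * R`,
  -- so Picard–Lindelöf reaches all of `[0,T]`; its solution stays within norm `R`, where the
  -- truncation is inactive.
  obtain ⟨R, hRdef⟩ : ∃ R, R = (‖x₀‖ + 1) * Real.exp ((L + 1) * T) := ⟨_, rfl⟩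
  have hR : 0 < R := hRdef ▸ by positivity
  have hpl : IsPicardLindelof (fun t y => A t (radialTruncation R y))
      (⟨0, le_rfl, hT⟩ : Icc (0 : ℝ) T) x₀ (L * R * T).toNNReal 0 (L * R).toNNReal
      (L * 2).toNNReal := by
    constructor
    · intro t ht
      refine LipschitzOnWith.of_dist_le_mul fun y _ z _ => ?_
      rw [dist_eq_norm, dist_eq_norm, ← map_sub, Real.coe_toNNReal _ (by positivity), mul_assoc]
      exact (A t).le_of_opNorm_le_of_le (hL t ht) (norm_radialTruncation_sub_le hR y z)
    · intro y _
      exact hA.clm_apply continuousOn_const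
    · intro t ht y _
      rw [Real.coe_toNNReal _ (by positivity)]
      exact (A t).le_of_opNorm_le_of_le (hL t ht) (norm_radialTruncation_le hR y)
    · rw [Real.coe_toNNReal _ (by positivity), Real.coe_toNNReal _ (by positivity)]
      simp [hT]
  obtain ⟨y, hy0, hy⟩ := hpl.exists_eq_forall_mem_Icc_hasDerivWithinAt₀
  refine ⟨y, hy0, fun t ht => ?_⟩
  have hbd := norm_le_mul_exp_of_norm_deriv_le (norm_nonneg x₀) hL0 zero_le_one hy
    (by simp only at hy0; rw [hy0]) (fun s hs =>
      ((A s).le_of_opNorm_le_of_le (hL s hs) (norm_radialTruncation_le_norm hR (y s))).trans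
        (by linarith)) t ht
  have := hy t ht
  rwa [radialTruncation_eq_self hR (hbd.trans_eq hRdef.symm)] at this

end LinearODE

/-! ### Continuous differentiability of the flow in the initial state. -/

section FlowRegularity

variable {n : ℕ} {X : Set (Euc n)} {F : Euc n → Euc n} {T : ℝ} {φ : ℝ → Euc n → Euc n}

/-- Uniform estimates for the derivative of a `C¹` map in a tube about a compact curve. -/
theorem exists_tube_fderiv_bounds (hX : IsOpen X) (hF : ContDiffOn ℝ 1 F X) {γ : ℝ → Euc n}
    (hγ : ContinuousOn γ (Icc 0 T)) (hmem : ∀ τ ∈ Icc 0 T, γ τ ∈ X) (hT : 0 ≤ T) :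
    ∃ r > 0, ∃ L, 0 ≤ L ∧
      (∀ τ ∈ Icc 0 T, Metric.closedBall (γ τ) r ⊆ X ∧
        ∀ z ∈ Metric.closedBall (γ τ) r, ‖fderiv ℝ F z‖ ≤ L) ∧
      ∀ η > 0, ∃ ρ > 0, ρ ≤ r ∧ ∀ τ ∈ Icc 0 T, ∀ z ∈ Metric.closedBall (γ τ) ρ,
        ‖fderiv ℝ F z - fderiv ℝ F (γ τ)‖ ≤ η := by
  have hc : IsCompact (γ '' Icc 0 T) := isCompact_Icc.image_of_continuousOn hγ
  obtain ⟨r, hr, hsub⟩ := hc.exists_cthickening_subset_open hX (image_subset_iff.2 hmem)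
  have hball : ∀ τ ∈ Icc 0 T, Metric.closedBall (γ τ) r ⊆ Metric.cthickening r (γ '' Icc 0 T) :=
    fun τ hτ => Metric.closedBall_subset_cthickening (mem_image_of_mem γ hτ) r
  have hDF : ContinuousOn (fderiv ℝ F) (Metric.cthickening r (γ '' Icc 0 T)) :=
    (hF.continuousOn_fderiv_of_isOpen hX le_rfl).mono hsub
  obtain ⟨L, hL⟩ := hc.cthickening.exists_bound_of_continuousOn hDF
  have h0 : (0 : ℝ) ∈ Icc 0 T := ⟨le_rfl, hT⟩
  refine ⟨r, hr, L, (norm_nonneg _).trans (hL _ (hball 0 h0 (Metric.mem_closedBall_self hr.le))),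
    fun τ hτ => ⟨(hball τ hτ).trans hsub, fun z hz => hL z (hball τ hτ hz)⟩, fun η hη => ?_⟩
  have huc := hc.cthickening.uniformContinuousOn_of_continuous hDF
  obtain ⟨δ, hδ, huc⟩ := Metric.uniformContinuousOn_iff_le.1 huc η hη
  refine ⟨min δ r, lt_min hδ hr, min_le_right _ _, fun τ hτ z hz => ?_⟩
  rw [Metric.mem_closedBall] at hz
  rw [← dist_eq_norm]
  exact huc z (hball τ hτ (hz.trans (min_le_right _ _))) _
    (hball τ hτ (Metric.mem_closedBall_self hr.le)) (hz.trans (min_le_left _ _))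

theorem IsNominalFlow.continuousOn_time (hφ : IsNominalFlow X F T φ) {x : Euc n} (hx : x ∈ X) :
    ContinuousOn (fun τ => φ τ x) (Icc 0 T) :=
  fun τ hτ => ((hφ x hx).2 τ hτ).2.continuousWithinAt

/-- Trajectories depend Lipschitz continuously on the initial state. -/
theorem IsNominalFlow.eventually_norm_sub_le (hX : IsOpen X) (hF : ContDiffOn ℝ 1 F X) (hT : 0 ≤ T)
    (hφ : IsNominalFlow X F T φ) {x₀ : Euc n} (hx₀ : x₀ ∈ X) :
    ∃ C, 0 ≤ C ∧ ∀ᶠ x in 𝓝 x₀, x ∈ X ∧ ∀ τ ∈ Icc 0 T, ‖φ τ x - φ τ x₀‖ ≤ C * ‖x - x₀‖ := by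
  obtain ⟨r, hr, L, hL0, hL, -⟩ := exists_tube_fderiv_bounds hX hF (hφ.continuousOn_time hx₀)
    (fun τ hτ => ((hφ x₀ hx₀).2 τ hτ).1) hT
  have hCpos : 0 < Real.exp ((L + 1) * T) := Real.exp_pos _
  refine ⟨_, hCpos.le, ?_⟩
  filter_upwards [hX.mem_nhds hx₀, Metric.ball_mem_nhds x₀ (div_pos hr hCpos)] with x hx hxr
  refine ⟨hx, fun τ hτ => ?_⟩
  rcases eq_or_ne x x₀ with rfl | hne
  · simp
  have hpos : 0 < ‖x - x₀‖ := norm_pos_iff.2 (sub_ne_zero.2 hne)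
  have hxr' : Real.exp ((L + 1) * T) * ‖x - x₀‖ < r := by
    rw [Metric.mem_ball, dist_eq_norm, lt_div_iff₀ hCpos] at hxr
    linarith
  have hexp : ∀ t ∈ Icc 0 T, Real.exp ((L + 1) * t) ≤ Real.exp ((L + 1) * T) := fun t ht =>
    Real.exp_le_exp.2 (mul_le_mul_of_nonneg_left ht.2 (by linarith))
  have hder : ∀ t ∈ Icc 0 T, HasDerivWithinAt (fun t => φ t x - φ t x₀)
      (F (φ t x) - F (φ t x₀)) (Icc 0 T) t := fun t ht =>
    ((hφ x hx).2 t ht).2.sub ((hφ x₀ hx₀).2 t ht).2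
  have hB : ∀ t, HasDerivAt (fun t => Real.exp ((L + 1) * t) * ‖x - x₀‖)
      ((L + 1) * (Real.exp ((L + 1) * t) * ‖x - x₀‖)) t := fun t => by
    have := (((hasDerivAt_id t).const_mul (L + 1)).exp).mul_const ‖x - x₀‖
    simp only [id, mul_one] at this
    exact this.congr_deriv (by ring)
  -- The Lipschitz bound on `F` holds only inside the tube. The fencing lemma compares derivatives
  -- only when the distance equals the barrier, which lies below `r`; the rate `L + 1 > L` makes
  -- that comparison strict.
  have := image_norm_le_of_norm_deriv_right_lt_deriv_boundary'
    (f := fun t => φ t x - φ t x₀) (fun t ht => (hder t ht).continuousWithinAt)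
    (fun t ht => (hder t (Ico_subset_Icc_self ht)).mono_of_mem_nhdsWithin
      (Icc_mem_nhdsGE_of_mem ht)) (B := fun t => Real.exp ((L + 1) * t) * ‖x - x₀‖)
    (by simp [(hφ x hx).1, (hφ x₀ hx₀).1])
    (fun t _ => (hB t).continuousAt.continuousWithinAt) (fun t _ => (hB t).hasDerivWithinAt)
    (fun t ht heq => by
      have ht' := Ico_subset_Icc_self ht
      have hle : ‖φ t x - φ t x₀‖ ≤ r :=
        (heq.trans_le (mul_le_mul_of_nonneg_right (hexp t ht') hpos.le)).trans hxr'.le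
      have hlip := (convex_closedBall (φ t x₀) r).norm_image_sub_le_of_norm_fderiv_le (𝕜 := ℝ)
        (f := F) (C := L)
        (fun z hz => (hF.differentiableOn one_ne_zero).differentiableAt
          (hX.mem_nhds ((hL t ht').1 hz)))
        (hL t ht').2 (Metric.mem_closedBall_self hr.le)
        (by rwa [Metric.mem_closedBall, dist_eq_norm])
      refine hlip.trans_lt ?_
      rw [heq]
      have : 0 < Real.exp ((L + 1) * t) * ‖x - x₀‖ := by positivity
      linarith) hτ
  exact this.trans (mul_le_mul_of_nonneg_right (hexp τ hτ) hpos.le)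

/-- The Lipschitz estimate is uniform in `τ`, which leaves only continuity in time along the fixed
trajectory of `x₀`. -/
theorem IsNominalFlow.continuousOn_uncurry (hX : IsOpen X) (hF : ContDiffOn ℝ 1 F X) (hT : 0 ≤ T)
    (hφ : IsNominalFlow X F T φ) :
    ContinuousOn (fun p : ℝ × Euc n => φ p.1 p.2) (Icc 0 T ×ˢ X) := by
  rintro ⟨τ₀, x₀⟩ ⟨hτ₀, hx₀⟩
  obtain ⟨C, hC, hlip⟩ := hφ.eventually_norm_sub_le hX hF hT hx₀
  have h1 : Tendsto (fun p : ℝ × Euc n => φ p.1 x₀) (𝓝[Icc 0 T ×ˢ X] (τ₀, x₀)) (𝓝 (φ τ₀ x₀)) :=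
    Tendsto.comp (hφ.continuousOn_time hx₀ τ₀ hτ₀)
      (continuous_fst.continuousWithinAt.tendsto_nhdsWithin fun p hp => hp.1)
  have h2 : Tendsto (fun p : ℝ × Euc n => φ p.1 p.2 - φ p.1 x₀)
      (𝓝[Icc 0 T ×ˢ X] (τ₀, x₀)) (𝓝 0) := by
    refine squeeze_zero_norm' (a := fun p : ℝ × Euc n => C * ‖p.2 - x₀‖) ?_ ?_
    · have := (continuous_snd.tendsto (τ₀, x₀)).eventually hlip
      filter_upwards [nhdsWithin_le_nhds this, self_mem_nhdsWithin] with p hp hp' using hp.2 _ hp'.1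
    · have : Continuous fun p : ℝ × Euc n => C * ‖p.2 - x₀‖ := by fun_prop
      simpa using (this.tendsto (τ₀, x₀)).mono_left nhdsWithin_le_nhds
  simpa using! h2.add h1

/-- `Φ` solves the variational equation along the trajectory of `x`. -/
def IsVariationalSolution (F : Euc n → Euc n) (T : ℝ) (φ : ℝ → Euc n → Euc n) (x : Euc n)
    (Φ : ℝ → Euc n →L[ℝ] Euc n) : Prop :=
  Φ 0 = ContinuousLinearMap.id ℝ (Euc n) ∧
    ∀ τ ∈ Icc 0 T, HasDerivWithinAt Φ ((fderiv ℝ F (φ τ x)).comp (Φ τ)) (Icc 0 T) τ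

/-- The variational equation is linear in the Banach space of operators, its coefficient being left
composition with the derivative of `F` along the trajectory. -/
theorem IsNominalFlow.exists_isVariationalSolution (hX : IsOpen X) (hF : ContDiffOn ℝ 1 F X)
    (hT : 0 ≤ T) (hφ : IsNominalFlow X F T φ) {x : Euc n} (hx : x ∈ X) :
    ∃ Φ, IsVariationalSolution F T φ x Φ := by
  have hc : ContinuousOn (fun τ => fderiv ℝ F (φ τ x)) (Icc 0 T) :=
    (hF.continuousOn_fderiv_of_isOpen hX le_rfl).comp (hφ.continuousOn_time hx)
      fun τ hτ => ((hφ x hx).2 τ hτ).1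
  exact exists_hasDerivWithinAt_linear hT
    (A := fun τ => ContinuousLinearMap.compL ℝ (Euc n) (Euc n) (Euc n) (fderiv ℝ F (φ τ x)))
    ((ContinuousLinearMap.compL ℝ (Euc n) (Euc n) (Euc n)).continuous.comp_continuousOn hc) _

/-- The remainder `φ t x - φ t x₀ - Φ t (x - x₀)` starts at 0 and solves the linearised equation up
to a Taylor error of `F`, at most `η * C * ‖x - x₀‖` with `η` small by uniform continuity of the
derivative. Grönwall's inequality concludes. -/
theorem IsNominalFlow.hasFDerivAt (hX : IsOpen X) (hF : ContDiffOn ℝ 1 F X)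
    (hT : 0 ≤ T) (hφ : IsNominalFlow X F T φ) {x₀ : Euc n} (hx₀ : x₀ ∈ X)
    {Φ : ℝ → Euc n →L[ℝ] Euc n} (hΦ : IsVariationalSolution F T φ x₀ Φ) {τ : ℝ} (hτ : τ ∈ Icc 0 T) :
    HasFDerivAt (φ τ) (Φ τ) x₀ := by
  obtain ⟨r, hr, L, hL0, hL, huc⟩ := exists_tube_fderiv_bounds hX hF (hφ.continuousOn_time hx₀)
    (fun τ hτ => ((hφ x₀ hx₀).2 τ hτ).1) hT
  obtain ⟨C, hC, hlip⟩ := hφ.eventually_norm_sub_le hX hF hT hx₀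
  rw [hasFDerivAt_iff_isLittleO, Asymptotics.isLittleO_iff]
  intro c hc
  have hE : 0 < Real.exp ((L + 1) * T) := Real.exp_pos _
  obtain ⟨ρ, hρ, hρr, hη⟩ := huc (c / (Real.exp ((L + 1) * T) * (C + 1))) (by positivity)
  obtain ⟨η, hηdef⟩ : ∃ η, η = c / (Real.exp ((L + 1) * T) * (C + 1)) := ⟨_, rfl⟩
  rw [← hηdef] at hη
  have hη0 : 0 < η := hηdef ▸ by positivity
  filter_upwards [hlip, Metric.ball_mem_nhds x₀ (show 0 < ρ / (C + 1) by positivity)]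
    with x hx hxρ
  rw [Metric.mem_ball, dist_eq_norm, lt_div_iff₀ (by positivity)] at hxρ
  have hclose : ∀ t ∈ Icc 0 T, ‖φ t x - φ t x₀‖ ≤ ρ := fun t ht => by
    nlinarith [hx.2 t ht, norm_nonneg (x - x₀)]
  have hder : ∀ t ∈ Icc 0 T, HasDerivWithinAt (fun t => φ t x - φ t x₀ - Φ t (x - x₀))
      (F (φ t x) - F (φ t x₀) - fderiv ℝ F (φ t x₀) (Φ t (x - x₀))) (Icc 0 T) t := fun t ht => by
    have h1 := (hΦ.2 t ht).clm_apply (hasDerivWithinAt_const t _ (x - x₀))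
    simp only [map_zero, add_zero, ContinuousLinearMap.comp_apply] at h1
    exact (((hφ x hx.1).2 t ht).2.sub ((hφ x₀ hx₀).2 t ht).2).sub h1
  have hbound := norm_le_mul_exp_of_norm_deriv_le le_rfl hL0
    (show 0 ≤ η * (C * ‖x - x₀‖) by positivity) hder
    (by simp [(hφ x hx.1).1, (hφ x₀ hx₀).1, hΦ.1])
    (fun t ht => by
      have hsub : Metric.closedBall (φ t x₀) ρ ⊆ Metric.closedBall (φ t x₀) r :=
        Metric.closedBall_subset_closedBall hρr
      have h1 := (convex_closedBall (φ t x₀) ρ).norm_image_sub_le_of_norm_fderiv_le' (𝕜 := ℝ)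
        (f := F) (C := η) (φ := fderiv ℝ F (φ t x₀))
        (fun z hz => (hF.differentiableOn one_ne_zero).differentiableAt
          (hX.mem_nhds ((hL t ht).1 (hsub hz))))
        (hη t ht) (Metric.mem_closedBall_self hρ.le)
        (by rw [Metric.mem_closedBall, dist_eq_norm]; exact hclose t ht)
      have h2 := (fderiv ℝ F (φ t x₀)).le_of_opNorm_le
        ((hL t ht).2 _ (Metric.mem_closedBall_self hr.le)) (φ t x - φ t x₀ - Φ t (x - x₀))
      have e : F (φ t x) - F (φ t x₀) - fderiv ℝ F (φ t x₀) (Φ t (x - x₀))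
          = fderiv ℝ F (φ t x₀) (φ t x - φ t x₀ - Φ t (x - x₀))
            + (F (φ t x) - F (φ t x₀) - fderiv ℝ F (φ t x₀) (φ t x - φ t x₀)) := by
        rw [map_sub (fderiv ℝ F (φ t x₀)) (φ t x - φ t x₀)]; abel
      rw [e]
      exact (norm_add_le _ _).trans (add_le_add h2
        (h1.trans (mul_le_mul_of_nonneg_left (hx.2 t ht) hη0.le)))) τ hτ
  refine hbound.trans ?_
  have : η * Real.exp ((L + 1) * T) * (C + 1) = c := by
    rw [hηdef]; field_simp
  rw [zero_add, ← this]
  have hn := norm_nonneg (x - x₀)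
  have : 0 ≤ η * Real.exp ((L + 1) * T) * ‖x - x₀‖ := by positivity
  nlinarith

theorem IsNominalFlow.differentiableAt (hX : IsOpen X) (hF : ContDiffOn ℝ 1 F X)
    (hT : 0 ≤ T) (hφ : IsNominalFlow X F T φ) {x : Euc n} (hx : x ∈ X) {τ : ℝ} (hτ : τ ∈ Icc 0 T) :
    DifferentiableAt ℝ (φ τ) x := by
  obtain ⟨Φ, hΦ⟩ := hφ.exists_isVariationalSolution hX hF hT hx
  exact (hφ.hasFDerivAt hX hF hT hx hΦ hτ).differentiableAt

theorem IsNominalFlow.isVariationalSolution_sensitivity (hX : IsOpen X) (hF : ContDiffOn ℝ 1 F X)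
    (hT : 0 ≤ T) (hφ : IsNominalFlow X F T φ) {x : Euc n} (hx : x ∈ X) :
    IsVariationalSolution F T φ x (fun τ => sensitivity φ τ x) := by
  obtain ⟨Φ, hΦ⟩ := hφ.exists_isVariationalSolution hX hF hT hx
  have heq : ∀ τ ∈ Icc 0 T, sensitivity φ τ x = Φ τ := fun τ hτ =>
    (hφ.hasFDerivAt hX hF hT hx hΦ hτ).fderiv
  refine ⟨(heq 0 ⟨le_rfl, hT⟩).trans hΦ.1, fun τ hτ => ?_⟩
  simp only [heq τ hτ]
  exact (hΦ.2 τ hτ).congr heq (heq τ hτ)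

/-- The difference of two sensitivities vanishes at time 0 and solves a linear equation forced by
the difference of the two coefficients applied to the sensitivity at `x₀`; that forcing is at most
`η * M`. -/
theorem IsNominalFlow.eventually_norm_sensitivity_sub_le (hX : IsOpen X) (hF : ContDiffOn ℝ 1 F X)
    (hT : 0 ≤ T) (hφ : IsNominalFlow X F T φ) {x₀ : Euc n} (hx₀ : x₀ ∈ X) {c : ℝ} (hc : 0 < c) :
    ∀ᶠ x in 𝓝 x₀, ∀ τ ∈ Icc 0 T, ‖sensitivity φ τ x - sensitivity φ τ x₀‖ ≤ c := by
  obtain ⟨r, hr, L, hL0, hL, huc⟩ := exists_tube_fderiv_bounds hX hF (hφ.continuousOn_time hx₀)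
    (fun τ hτ => ((hφ x₀ hx₀).2 τ hτ).1) hT
  obtain ⟨C, hC, hlip⟩ := hφ.eventually_norm_sub_le hX hF hT hx₀
  have hΦ₀ := hφ.isVariationalSolution_sensitivity hX hF hT hx₀
  obtain ⟨M, hM⟩ := isCompact_Icc.exists_bound_of_continuousOn
    (f := fun τ => sensitivity φ τ x₀) (s := Icc 0 T)
    (fun τ hτ => (hΦ₀.2 τ hτ).continuousWithinAt)
  have hM0 : 0 ≤ M := (norm_nonneg _).trans (hM 0 ⟨le_rfl, hT⟩)
  have hE : 0 < Real.exp ((L + 1) * T) := Real.exp_pos _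
  obtain ⟨η, hηdef⟩ : ∃ η, η = c / (Real.exp ((L + 1) * T) * (M + 1)) := ⟨_, rfl⟩
  have hη0 : 0 < η := hηdef ▸ by positivity
  obtain ⟨ρ, hρ, hρr, hη⟩ := huc η hη0
  filter_upwards [hlip, Metric.ball_mem_nhds x₀ (show 0 < ρ / (C + 1) by positivity)]
    with x hx hxρ τ hτ
  rw [Metric.mem_ball, dist_eq_norm, lt_div_iff₀ (by positivity)] at hxρ
  have hclose : ∀ t ∈ Icc 0 T, φ t x ∈ Metric.closedBall (φ t x₀) ρ := fun t ht => by
    rw [Metric.mem_closedBall, dist_eq_norm]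
    nlinarith [hx.2 t ht, norm_nonneg (x - x₀)]
  have hΦ := hφ.isVariationalSolution_sensitivity hX hF hT hx.1
  have hbound := norm_le_mul_exp_of_norm_deriv_le le_rfl hL0
    (show 0 ≤ η * M by positivity) (fun t ht => (hΦ.2 t ht).sub (hΦ₀.2 t ht))
    (by simp only [Pi.sub_apply, hΦ.1, hΦ₀.1]; simp)
    (fun t ht => by
      have e : (fderiv ℝ F (φ t x)).comp (sensitivity φ t x)
          - (fderiv ℝ F (φ t x₀)).comp (sensitivity φ t x₀)
          = (fderiv ℝ F (φ t x)).comp (sensitivity φ t x - sensitivity φ t x₀)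
            + (fderiv ℝ F (φ t x) - fderiv ℝ F (φ t x₀)).comp (sensitivity φ t x₀) := by
        rw [ContinuousLinearMap.comp_sub, ContinuousLinearMap.sub_comp]; abel
      rw [e]
      refine (norm_add_le _ _).trans (add_le_add ?_ ?_)
      · exact (ContinuousLinearMap.opNorm_comp_le _ _).trans (mul_le_mul_of_nonneg_right
          ((hL t ht).2 _ (Metric.closedBall_subset_closedBall hρr (hclose t ht))) (norm_nonneg _))
      · exact (ContinuousLinearMap.opNorm_comp_le _ _).trans
          (mul_le_mul (hη t ht _ (hclose t ht)) (hM t ht) (norm_nonneg _) hη0.le)) τ hτ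
  refine hbound.trans ?_
  have : η * Real.exp ((L + 1) * T) * (M + 1) = c := by
    rw [hηdef]; field_simp
  rw [zero_add, ← this]
  have : 0 < η * Real.exp ((L + 1) * T) := by positivity
  nlinarith

theorem IsNominalFlow.continuousOn_sensitivity (hX : IsOpen X) (hF : ContDiffOn ℝ 1 F X)
    (hT : 0 ≤ T) (hφ : IsNominalFlow X F T φ) :
    ContinuousOn (fun p : ℝ × Euc n => sensitivity φ p.1 p.2) (Icc 0 T ×ˢ X) := by
  rintro ⟨τ₀, x₀⟩ ⟨hτ₀, hx₀⟩
  have hΦ₀ := hφ.isVariationalSolution_sensitivity hX hF hT hx₀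
  have h1 : Tendsto (fun p : ℝ × Euc n => sensitivity φ p.1 x₀) (𝓝[Icc 0 T ×ˢ X] (τ₀, x₀))
      (𝓝 (sensitivity φ τ₀ x₀)) :=
    Tendsto.comp (hΦ₀.2 τ₀ hτ₀).continuousWithinAt
      (continuous_fst.continuousWithinAt.tendsto_nhdsWithin fun p hp => hp.1)
  have h2 : Tendsto (fun p : ℝ × Euc n => sensitivity φ p.1 p.2 - sensitivity φ p.1 x₀)
      (𝓝[Icc 0 T ×ˢ X] (τ₀, x₀)) (𝓝 0) := by
    rw [Metric.tendsto_nhds]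
    intro c hc
    have := (continuous_snd.tendsto (τ₀, x₀)).eventually
      (hφ.eventually_norm_sensitivity_sub_le hX hF hT hx₀ (half_pos hc))
    filter_upwards [nhdsWithin_le_nhds this, self_mem_nhdsWithin] with p hp hp'
    rw [dist_zero_right]
    exact (hp _ hp'.1).trans_lt (half_lt_self hc)
  simpa using! h2.add h1

end FlowRegularity

/-! ### Extremum arguments on an interval and uniform positivity over a compact index space. -/

section Barrier

/-- The derivative at the right end of an interval is nonpositive where the minimum is attained. -/
theorem hasDerivWithinAt_nonpos_of_le {ψ : ℝ → ℝ} {c a b : ℝ} (hab : a < b)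
    (hψ : HasDerivWithinAt ψ c (Icc a b) b) (hmin : ∀ t ∈ Ico a b, ψ b ≤ ψ t) : c ≤ 0 := by
  have h := (hasDerivWithinAt_iff_tendsto_slope' (s := Ico a b) (by simp)).1
    (hψ.mono Ico_subset_Icc_self)
  have : (𝓝[Ico a b] b).NeBot := by
    rw [nhdsWithin_Ico_eq_nhdsLT hab]; infer_instance
  refine le_of_tendsto h ?_
  filter_upwards [self_mem_nhdsWithin] with t ht
  rw [slope_def_field]
  exact div_nonpos_of_nonneg_of_nonpos (sub_nonneg.2 (hmin t ht)) (by linarith [ht.2])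

/-- A function that starts nonnegative and increases wherever it is nonpositive is positive at later
times. -/
theorem pos_of_deriv_pos_of_nonpos {ψ ψ' : ℝ → ℝ} {b : ℝ} (hb : 0 < b)
    (hψ : ∀ t ∈ Icc 0 b, HasDerivWithinAt ψ (ψ' t) (Icc 0 b) t) (h0 : 0 ≤ ψ 0)
    (hpos : ∀ t ∈ Icc 0 b, ψ t ≤ 0 → 0 < ψ' t) : 0 < ψ b := by
  by_contra! hneg
  obtain ⟨t, ht, hmin⟩ := isCompact_Icc.exists_isMinOn (nonempty_Icc.2 hb.le)
    (fun t ht => (hψ t ht).continuousWithinAt)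
  have hcontra : ∀ s ∈ Icc 0 b, 0 < s → ψ s ≤ 0 → (∀ u ∈ Ico 0 s, ψ s ≤ ψ u) → False :=
    fun s hs hs0 hle hu => (hpos s hs hle).not_ge
      (hasDerivWithinAt_nonpos_of_le hs0 ((hψ s hs).mono (Icc_subset_Icc_right hs.2)) hu)
  have hbmem : b ∈ Icc 0 b := ⟨hb.le, le_rfl⟩
  -- A minimum at 0 admits no left difference quotient, but then `ψ b ≤ 0 ≤ ψ 0` makes `b` a
  -- minimiser as well.
  rcases ht.1.eq_or_lt with rfl | ht0
  · exact hcontra b hbmem hb hneg fun u hu =>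
      (hneg.trans h0).trans (hmin (Ico_subset_Icc_self hu))
  · exact hcontra t ht ht0 ((hmin hbmem).trans hneg) fun u hu => hmin ⟨hu.1, hu.2.le.trans ht.2⟩

/-- A family of functions, continuous over a compact index space, that is positive at a point is
bounded below by a positive constant nearby. -/
theorem exists_pos_eventually_forall_lt {ι E : Type*} [TopologicalSpace ι] [CompactSpace ι]
    [TopologicalSpace E] {Q : ι → E → ℝ} {x₀ : E}
    (hQ : ∀ i, ContinuousAt (fun p : ι × E => Q p.1 p.2) (i, x₀)) (hpos : ∀ i, 0 < Q i x₀) :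
    ∃ c > 0, ∀ᶠ y in 𝓝 x₀, ∀ i, c < Q i y := by
  rcases isEmpty_or_nonempty ι with _ | _
  · exact ⟨1, one_pos, by simp⟩
  have hc : Continuous fun i => Q i x₀ := continuous_iff_continuousAt.2 fun i =>
    ContinuousAt.comp (f := fun i => (i, x₀)) (hQ i) (by fun_prop)
  obtain ⟨j, -, hj⟩ := isCompact_univ.exists_isMinOn univ_nonempty hc.continuousOn
  refine ⟨Q j x₀ / 2, half_pos (hpos j), ?_⟩
  have := isCompact_univ.eventually_forall_of_forall_eventually (x₀ := x₀) (K := (univ : Set ι))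
    (P := fun y i => Q j x₀ / 2 < Q i y) (fun i _ => by
      have hsw : ContinuousAt (fun z : E × ι => Q z.2 z.1) (x₀, i) :=
        ContinuousAt.comp (f := fun z : E × ι => (z.2, z.1)) (x := (x₀, i)) (hQ i) (by fun_prop)
      exact hsw.eventually (lt_mem_nhds ((half_lt_self (hpos j)).trans_le (hj (mem_univ i)))))
  simpa using this

end Barrier

/-! ### Local invariance under a compact family of constraints. -/

section Invariance

variable {ι E : Type*} [TopologicalSpace ι] [CompactSpace ι] [NormedAddCommGroup E]
  [NormedSpace ℝ E]

/-- If a continuous curve starts where all constraints of a compact family are positive, and each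
constraint increases along the curve whenever it becomes active inside the feasible set, then the
curve remains feasible. -/
theorem forall_pos_of_deriv_pos_of_active {H : ι → E → ℝ} {G : ι → E → E →L[ℝ] ℝ} {W : Set E}
    (hH : ∀ i, ∀ y ∈ W, ContinuousAt (fun p : ι × E => H p.1 p.2) (i, y))
    (hG : ∀ i, ∀ y ∈ W, HasFDerivAt (H i) (G i y) y) {a b : ℝ} {y y' : ℝ → E}
    (hyc : ContinuousOn y (Icc a b)) (hyW : ∀ t ∈ Icc a b, y t ∈ W)
    (hy : ∀ t ∈ Ioc a b, HasDerivWithinAt y (y' t) (Icc a b) t) (h0 : ∀ i, 0 < H i (y a))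
    (hact : ∀ t ∈ Ioc a b, (∀ i, 0 ≤ H i (y t)) → ∀ i, H i (y t) = 0 → 0 < G i (y t) (y' t)) :
    ∀ t ∈ Icc a b, ∀ i, 0 < H i (y t) := by
  by_contra! hbad
  obtain ⟨s, hs, i, hi⟩ := hbad
  have hcont : ContinuousOn (fun p : ι × ℝ => H p.1 (y p.2)) (univ ×ˢ Icc a b) := by
    rintro ⟨j, t⟩ ⟨-, ht⟩
    refine ContinuousAt.comp_continuousWithinAt (g := fun p : ι × E => H p.1 p.2)
      (f := fun p : ι × ℝ => (p.1, y p.2)) (x := (j, t)) (hH j (y t) (hyW t ht)) ?_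
    exact continuousWithinAt_fst.prodMk
      (ContinuousWithinAt.comp (hyc t ht) continuousWithinAt_snd fun p hp => hp.2)
  have hsub : ∀ t ∈ Icc a b, ∀ j, ContinuousWithinAt (fun t => H j (y t)) (Icc a b) t :=
    fun t ht j => ((hG j _ (hyW t ht)).continuousAt).comp_continuousWithinAt (hyc t ht)
  -- Compactness of the index space yields a first time at which some constraint fails to be
  -- positive, even for infinitely many constraints.
  have hcpt : IsCompact {p : ι × ℝ | p ∈ univ ×ˢ Icc a b ∧ H p.1 (y p.2) ≤ 0} := by
    obtain ⟨u, hu, he⟩ := continuousOn_iff_isClosed.1 hcont (Iic 0) isClosed_Iic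
    have : {p : ι × ℝ | p ∈ univ ×ˢ Icc a b ∧ H p.1 (y p.2) ≤ 0} = (univ ×ˢ Icc a b) ∩ u := by
      rw [inter_comm, ← he]; ext p; simp [and_comm]
    rw [this]
    exact (isCompact_univ.prod isCompact_Icc).inter_right hu
  obtain ⟨t, ⟨⟨j, t'⟩, ⟨⟨-, ht⟩, hj⟩, rfl⟩, hleast⟩ := (hcpt.image continuous_snd).exists_isLeast
    ⟨s, ⟨(i, s), ⟨⟨mem_univ _, hs⟩, hi⟩, rfl⟩⟩
  simp only at ht hj hleast
  have hat : a < t' := ht.1.lt_of_ne fun h => (h0 j).not_ge (h ▸ hj)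
  have hbefore : ∀ u ∈ Ico a t', ∀ l, 0 < H l (y u) := fun u hu l => by
    by_contra! hle
    exact hu.2.not_ge (hleast ⟨(l, u), ⟨⟨mem_univ _, hu.1, hu.2.le.trans ht.2⟩, hle⟩, rfl⟩)
  have hIco : Ico a t' ⊆ Icc a b := fun u hu => ⟨hu.1, hu.2.le.trans ht.2⟩
  have : (𝓝[Ico a t'] t').NeBot := by
    rw [nhdsWithin_Ico_eq_nhdsLT hat]; infer_instance
  have hnonneg : ∀ l, 0 ≤ H l (y t') := fun l =>
    ge_of_tendsto ((hsub t' ht l).mono hIco) (by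
      filter_upwards [self_mem_nhdsWithin] with u hu using (hbefore u hu l).le)
  have hzero : H j (y t') = 0 := hj.antisymm (hnonneg j)
  have hder := ((hG j _ (hyW t' ht)).comp_hasDerivWithinAt t' (hy t' ⟨hat, ht.2⟩)).mono
    (Icc_subset_Icc_right ht.2)
  exact (hact t' ⟨hat, ht.2⟩ hnonneg j hzero).not_ge (hasDerivWithinAt_nonpos_of_le hat hder
    fun u hu => hzero.le.trans (hbefore u hu j).le)

/-- Local form of Nagumo's theorem for a compact family of constraints, under bounded disturbances.
At `x a` the vector `v` points strictly into the feasible set. -/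
theorem exists_forall_nonneg_of_robust_constraints {H : ι → E → ℝ} {G : ι → E → E →L[ℝ] ℝ}
    {X : Set E} (hX : IsOpen X)
    (hH : ∀ i, ∀ y ∈ X, ContinuousAt (fun p : ι × E => H p.1 p.2) (i, y))
    (hG : ∀ i, ∀ y ∈ X, HasFDerivAt (H i) (G i y) y)
    (hGc : ∀ i, ∀ y ∈ X, ContinuousAt (fun p : ι × E => G p.1 p.2) (i, y))
    {F : E → E} {ξ : ℝ} (hrob : ∀ y ∈ X, (∀ i, 0 ≤ H i y) → ∀ i, H i y = 0 →
      ξ * ‖G i y‖ ≤ G i y (F y))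
    {d : ℝ → E} {a b : ℝ} (hab : a < b) (hd : ∀ t ∈ Icc a b, ‖d t‖ ≤ ξ) {x : ℝ → E}
    (hxc : ContinuousOn x (Icc a b)) {D : Set ℝ} (hD : D.Finite)
    (hx : ∀ t ∈ Icc a b \ D, HasDerivWithinAt x (F (x t) + d t) (Icc a b) t)
    (hxa : x a ∈ X) {K : NNReal} {V : Set E} (hV : V ∈ 𝓝 (x a)) (hF : LipschitzOnWith K F V)
    (h0 : ∀ i, 0 ≤ H i (x a)) {v : E} (hv : ∀ i, H i (x a) = 0 → 0 < G i (x a) v) :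
    ∃ b' ∈ Ioc a b, ∀ t ∈ Icc a b', ∀ i, 0 ≤ H i (x t) := by
  -- At `x a` each constraint is either inactive or strictly increasing along `v`, so the maximum is
  -- positive. Compactness makes this uniform nearby: wherever `H i y ≤ 0`, the derivative along `v`
  -- exceeds `c`.
  obtain ⟨c, hc, hcv⟩ := exists_pos_eventually_forall_lt
    (Q := fun i y => max (H i y) (G i y v)) (x₀ := x a)
    (fun i => (hH i _ hxa).max ((hGc i _ hxa).clm_apply continuousAt_const))
    (fun i => (h0 i).lt_or_eq.elim (fun h => lt_max_of_lt_left h)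
      fun h => lt_max_of_lt_right (hv i h.symm))
  -- Taking reciprocals turns a uniform lower bound into an upper bound on `‖G i y‖`.
  obtain ⟨c', hc', hcG⟩ := exists_pos_eventually_forall_lt
    (Q := fun i y => (1 + ‖G i y‖)⁻¹) (x₀ := x a)
    (fun i => (continuousAt_const.add (hGc i _ hxa).norm).inv₀
      (add_pos_of_pos_of_nonneg one_pos (norm_nonneg _)).ne')
    (fun i => by positivity)
  obtain ⟨ρ, hρ, hball⟩ := Metric.eventually_nhds_iff_ball.1
    (((hX.eventually_mem hxa).and (eventually_mem_set.2 hV)).and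
      (hcv.and hcG))
  obtain ⟨M, hMdef⟩ : ∃ M, M = c'⁻¹ := ⟨_, rfl⟩
  have hM0 : 0 < M := hMdef ▸ inv_pos.2 hc'
  have hM : ∀ y ∈ Metric.ball (x a) ρ, ∀ i, ‖G i y‖ ≤ M := fun y hy i => by
    have h1 : 0 < 1 + ‖G i y‖ := by positivity
    have h2 := (lt_inv_comm₀ hc' h1).1 ((hball y hy).2.2 i)
    linarith
  have hGv : ∀ y ∈ Metric.ball (x a) ρ, ∀ i, H i y ≤ 0 → c < G i y v := fun y hy i hi =>
    (lt_max_iff.1 ((hball y hy).2.1 i)).resolve_left (by linarith)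
  -- an interval free of exceptional times on which the solution stays close to its start
  obtain ⟨b', hb', hbclose⟩ : ∃ b' ∈ Ioc a b, ∀ t ∈ Icc a b',
      dist (x t) (x a) < ρ / 2 ∧ (t ≠ a → t ∉ D) := by
    have e1 : ∀ᶠ t in 𝓝[≥] a, dist (x t) (x a) < ρ / 2 := by
      have := hxc a ⟨le_rfl, hab.le⟩
      rw [ContinuousWithinAt, nhdsWithin_Icc_eq_nhdsGE hab] at this
      exact this.eventually (Metric.ball_mem_nhds _ (half_pos hρ))
    have e2 : ∀ᶠ t in 𝓝 a, t ∉ D \ {a} :=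
      (hD.subset sdiff_subset).isClosed.isOpen_compl.mem_nhds (by simp)
    obtain ⟨u, hu, huP⟩ := (mem_nhdsGE_iff_exists_Icc_subset).1
      (e1.and (nhdsWithin_le_nhds e2))
    refine ⟨min u b, ⟨lt_min hu hab, min_le_right _ _⟩, fun t ht => ?_⟩
    obtain ⟨h1, h2⟩ := huP ⟨ht.1, ht.2.trans (min_le_left _ _)⟩
    exact ⟨h1, fun hta htD => h2 ⟨htD, hta⟩⟩
  have hsubI : Icc a b' ⊆ Icc a b := Icc_subset_Icc_right hb'.2
  have hxball : ∀ t ∈ Icc a b', x t ∈ Metric.ball (x a) ρ := fun t ht =>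
    Metric.ball_subset_ball (half_le_self hρ.le) (hbclose t ht).1
  -- For a shift of size `p`, the gain `κ * p * c` exceeds the Lipschitz error `M * K * p * ‖v‖` by
  -- exactly `p`.
  obtain ⟨κ, hκdef⟩ : ∃ κ, κ = (M * (K * ‖v‖) + 1) / c := ⟨_, rfl⟩
  have hκ : κ * c = M * (K * ‖v‖) + 1 := by rw [hκdef]; field_simp
  have hκ0 : 0 < κ := hκdef ▸ by positivity
  have hE : 0 < Real.exp (κ * (b' - a)) := Real.exp_pos _
  obtain ⟨η₀, hη₀def⟩ : ∃ η₀, η₀ = ρ / 2 / (Real.exp (κ * (b' - a)) * (‖v‖ + 1)) := ⟨_, rfl⟩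
  have hη₀ : 0 < η₀ := hη₀def ▸ by positivity
  have hη₀' : η₀ * Real.exp (κ * (b' - a)) * (‖v‖ + 1) = ρ / 2 := by
    rw [hη₀def]; field_simp
  have hpert : ∀ η ∈ Ioo 0 η₀, ∀ t ∈ Icc a b', ∀ i,
      0 < H i (x t + (η * Real.exp (κ * (t - a))) • v) := by
    intro η hη
    have hsmall : ∀ p, 0 ≤ p → p ≤ η * Real.exp (κ * (b' - a)) → ‖p • v‖ < ρ / 2 := by
      intro p hp0 hp
      rw [norm_smul, Real.norm_of_nonneg hp0, ← hη₀']
      have h1 : η * Real.exp (κ * (b' - a)) < η₀ * Real.exp (κ * (b' - a)) :=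
        mul_lt_mul_of_pos_right hη.2 hE
      nlinarith [norm_nonneg v]
    have hple : ∀ t ∈ Icc a b', η * Real.exp (κ * (t - a)) ≤ η * Real.exp (κ * (b' - a)) :=
      fun t ht => mul_le_mul_of_nonneg_left
        (Real.exp_le_exp.2 (mul_le_mul_of_nonneg_left (by linarith [ht.2]) hκ0.le)) hη.1.le
    have hp0 : ∀ t, 0 < η * Real.exp (κ * (t - a)) := fun t => mul_pos hη.1 (Real.exp_pos _)
    have hyball : ∀ t ∈ Icc a b', x t + (η * Real.exp (κ * (t - a))) • v ∈ Metric.ball (x a) ρ := by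
      intro t ht
      rw [Metric.mem_ball, dist_eq_norm, add_sub_right_comm]
      have h1 := (hbclose t ht).1
      rw [dist_eq_norm] at h1
      have h2 := hsmall _ (hp0 t).le (hple t ht)
      exact (norm_add_le _ _).trans_lt (by linarith)
    have hp' : ∀ t, HasDerivAt (fun t => η * Real.exp (κ * (t - a)))
        (κ * (η * Real.exp (κ * (t - a)))) t := fun t => by
      have := ((((hasDerivAt_id t).sub_const a).const_mul κ).exp).const_mul η
      simp only [id, mul_one] at this
      exact this.congr_deriv (by ring)
    refine forall_pos_of_deriv_pos_of_active (W := Metric.ball (x a) ρ)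
      (fun i y hy => hH i y (hball y hy).1.1) (fun i y hy => hG i y (hball y hy).1.1)
      (y' := fun t => F (x t) + d t + (κ * (η * Real.exp (κ * (t - a)))) • v) ?_ hyball ?_ ?_ ?_
    · exact (hxc.mono hsubI).add (by fun_prop)
    · intro t ht
      have hta : t ∉ D := (hbclose t (Ioc_subset_Icc_self ht)).2 ht.1.ne'
      exact ((hx t ⟨hsubI (Ioc_subset_Icc_self ht), hta⟩).mono hsubI).add
        ((hp' t).smul_const v).hasDerivWithinAt
    · intro i
      have hseg : ∀ s ∈ Icc 0 η, x a + s • v ∈ Metric.ball (x a) ρ := fun s hs => by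
        rw [Metric.mem_ball, dist_eq_norm, add_sub_cancel_left]
        have : η ≤ η * Real.exp (κ * (b' - a)) := le_mul_of_one_le_right hη.1.le
          (Real.one_le_exp (mul_nonneg hκ0.le (by linarith [hb'.1])))
        linarith [hsmall s hs.1 (hs.2.trans this)]
      -- Strict feasibility at the initial time: along the segment from `x a` in direction `v`, the
      -- constraint increases wherever it is nonpositive.
      have := pos_of_deriv_pos_of_nonpos (ψ := fun s => H i (x a + s • v))
        (ψ' := fun s => G i (x a + s • v) v) hη.1
        (fun s hs => by
          have h1 : HasDerivWithinAt (fun s : ℝ => x a + s • v) v (Icc 0 η) s := by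
            simpa using (((hasDerivAt_id s).smul_const v).const_add (x a)).hasDerivWithinAt
          exact (hG i _ (hball _ (hseg s hs)).1.1).comp_hasDerivWithinAt s h1)
        (by simpa using h0 i)
        (fun s hs hle => hc.trans (hGv _ (hseg s hs) i hle))
      simpa using this
    · intro t ht hall i hi
      have ht' := Ioc_subset_Icc_self ht
      obtain ⟨p, hpdef⟩ : ∃ p, p = η * Real.exp (κ * (t - a)) := ⟨_, rfl⟩
      have hp : 0 < p := hpdef ▸ hp0 t
      have hy := hyball t ht'
      rw [← hpdef] at hall hi hy ⊢
      -- The robust inequality is used at the shifted point, feasible at contact; the velocity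
      -- involves `F` at `x t`, and `g4` bounds the discrepancy.
      have g1 := hrob _ (hball _ hy).1.1 hall i hi
      have g2 := hGv _ hy i hi.le
      have g3 : |G i (x t + p • v) (d t)| ≤ ξ * ‖G i (x t + p • v)‖ := by
        rw [mul_comm]
        exact (G i (x t + p • v)).le_of_opNorm_le_of_le le_rfl (hd t (hsubI ht'))
      have g4 : |G i (x t + p • v) (F (x t) - F (x t + p • v))| ≤ M * (K * (p * ‖v‖)) := by
        refine (G i (x t + p • v)).le_of_opNorm_le_of_le (hM _ hy i) ?_
        have := hF.dist_le_mul _ (hball _ (hxball t ht')).1.2 _ (hball _ hy).1.2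
        rwa [dist_eq_norm, dist_eq_norm, sub_add_cancel_left, norm_neg, norm_smul,
          Real.norm_of_nonneg hp.le] at this
      have e : F (x t) + d t + (κ * p) • v
          = F (x t + p • v) + d t + (F (x t) - F (x t + p • v)) + (κ * p) • v := by abel
      rw [e, map_add, map_add, map_add, map_smul, smul_eq_mul]
      have g5 : κ * p * c ≤ κ * p * G i (x t + p • v) v :=
        mul_le_mul_of_nonneg_left g2.le (by positivity)
      have g6 : κ * p * c = M * (K * (p * ‖v‖)) + p := by
        rw [mul_right_comm, hκ]; ring
      linarith [(abs_le.1 g3).1, (abs_le.1 g4).1]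
  refine ⟨b', hb', fun t ht i => ?_⟩
  have hcont : ContinuousAt (H i) (x t) := (hG i _ (hball _ (hxball t ht)).1.1).continuousAt
  have hlim : Tendsto (fun η : ℝ => H i (x t + (η * Real.exp (κ * (t - a))) • v)) (𝓝[>] 0)
      (𝓝 (H i (x t))) := by
    refine hcont.tendsto.comp ?_
    have : Continuous fun η : ℝ => x t + (η * Real.exp (κ * (t - a))) • v := by fun_prop
    simpa using (this.tendsto 0).mono_left nhdsWithin_le_nhds
  refine ge_of_tendsto hlim ?_
  filter_upwards [Ioo_mem_nhdsGT hη₀] with η hη using (hpert η hη t ht i).le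

end Invariance

/-! ### From local to global invariance. -/

section ForwardInvariance

variable {ι : Type*} [TopologicalSpace ι] [CompactSpace ι] {n : ℕ}

/-- Forward invariance of a set cut out by a compact family of `C¹` constraints, for a vector field
that satisfies the constraints robustly against disturbances of norm at most `ξ`. -/
theorem isForwardInvariantAlong_of_robust_constraints {H : ι → Euc n → ℝ}
    {G : ι → Euc n → Euc n →L[ℝ] ℝ} {X C : Set (Euc n)} (hX : IsOpen X)
    (hH : ∀ i, ∀ y ∈ X, ContinuousAt (fun p : ι × Euc n => H p.1 p.2) (i, y))
    (hG : ∀ i, ∀ y ∈ X, HasFDerivAt (H i) (G i y) y)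
    (hGc : ∀ i, ∀ y ∈ X, ContinuousAt (fun p : ι × Euc n => G p.1 p.2) (i, y))
    (hC : ∀ y, y ∈ C ↔ y ∈ X ∧ ∀ i, 0 ≤ H i y)
    (hreg : ∀ y ∈ C, y ∈ frontier C → ∀ i, H i y = 0 → G i y ≠ 0)
    {F : Euc n → Euc n} (hF : LocallyLipschitzOn X F) {ξ : ℝ} (hξ : 0 < ξ)
    (hrob : ∀ y ∈ C, ∀ i, H i y = 0 → ξ * ‖G i y‖ ≤ G i y (F y))
    {d : ℝ → Euc n} (hd : ∀ t, 0 ≤ t → ‖d t‖ ≤ ξ) :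
    IsForwardInvariantAlong X (disturbed F d) C := by
  rintro S hS x ⟨hxc, hxX, D, hD, hx⟩ hx0
  have hclosed : IsClosed ({t | ∀ i, 0 ≤ H i (x t)} ∩ Icc 0 S) := by
    have e : {t | ∀ i, 0 ≤ H i (x t)} ∩ Icc 0 S
        = Icc 0 S ∩ ⋂ i, Icc 0 S ∩ (fun t => H i (x t)) ⁻¹' Ici 0 := by
      ext t
      simp only [mem_inter_iff, mem_ofPred_eq, mem_iInter, mem_preimage, mem_Ici]
      exact ⟨fun h => ⟨h.2, fun i => ⟨h.2, h.1 i⟩⟩, fun h => ⟨fun i => (h.2 i).2, h.1⟩⟩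
    rw [e]
    refine isClosed_Icc.inter (isClosed_iInter fun i => ?_)
    refine ContinuousOn.preimage_isClosed_of_isClosed (fun t ht => ?_) isClosed_Icc isClosed_Ici
    exact ((hG i _ (hxX t ht)).continuousAt).comp_continuousWithinAt (hxc t ht)
  suffices hsub : Icc 0 S ⊆ {t | ∀ i, 0 ≤ H i (x t)} from
    fun t ht => (hC _).2 ⟨hxX t ht, hsub ht⟩
  -- Continuous induction: the feasible times form a closed set, so each must be extended slightly
  -- to the right.
  refine hclosed.Icc_subset_of_forall_exists_gt ((hC _).1 hx0).2 ?_
  rintro t₀ ⟨h0, ht₀⟩ b hb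
  have ht₀' : t₀ ∈ Icc 0 S := Ico_subset_Icc_self ht₀
  have hxt₀ : x t₀ ∈ C := (hC _).2 ⟨hxX t₀ ht₀', h0⟩
  obtain ⟨c, hcdef⟩ : ∃ c, c = min b S := ⟨_, rfl⟩
  have hc : t₀ < c := hcdef ▸ lt_min hb ht₀.2
  have hcb : c ≤ b := hcdef ▸ min_le_left _ _
  have hsub : Icc t₀ c ⊆ Icc 0 S := Icc_subset_Icc ht₀.1 (hcdef ▸ min_le_right _ _)
  by_cases hint : x t₀ ∈ interior C
  · have h1 : ∀ᶠ t in 𝓝[Icc t₀ c] t₀, x t ∈ C :=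
      ((hxc t₀ ht₀').mono hsub).eventually (mem_interior_iff_mem_nhds.1 hint)
    have h2 : ∀ᶠ t in 𝓝[>] t₀, x t ∈ C := by
      rw [nhdsWithin_Icc_eq_nhdsGE hc] at h1
      exact nhdsWithin_mono _ Ioi_subset_Ici_self h1
    obtain ⟨t, ht, htI⟩ := (h2.and (Ioc_mem_nhdsGT hb)).exists
    exact ⟨t, ((hC _).1 ht).2, htI⟩
  · have hfront : x t₀ ∈ frontier C := ⟨subset_closure hxt₀, hint⟩
    obtain ⟨K, V, hV, hFV⟩ := hF (hxX t₀ ht₀')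
    rw [hX.nhdsWithin_eq (hxX t₀ ht₀')] at hV
    -- The field itself serves as inward vector: the nonzero gradients on the frontier give `G i (F
    -- (x t₀)) ≥ ξ * ‖G i‖ > 0` for all active `i`.
    obtain ⟨b', hb', hfin⟩ := exists_forall_nonneg_of_robust_constraints hX hH hG hGc
      (F := F) (ξ := ξ) (fun y hy hall i hi => hrob y ((hC y).2 ⟨hy, hall⟩) i hi)
      hc (fun t ht => hd t (hsub ht).1) (hxc.mono hsub) hD
      (fun t ht => (hx t ⟨hsub ht.1, ht.2⟩).mono hsub) (hxX t₀ ht₀') hV hFV h0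
      (v := F (x t₀)) (fun i hi => (mul_pos hξ (norm_pos_iff.2 (hreg _ hxt₀ hfront i hi))).trans_le
        (hrob _ hxt₀ i hi))
    exact ⟨b', hfin b' ⟨hb'.1.le, le_rfl⟩, hb'.1, hb'.2.trans hcb⟩

end ForwardInvariance

/-! ### Regularity of the constraints and of the closed loop. -/

section ConstraintRegularity

variable {n : ℕ} {X : Set (Euc n)} {F : Euc n → Euc n} {T : ℝ} {φ : ℝ → Euc n → Euc n}
  {h : Euc n → ℝ}

theorem ContinuousOn.continuousAt_subtype_prod {α β γ : Type*} [TopologicalSpace α]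
    [TopologicalSpace β] [TopologicalSpace γ] {s : Set α} {X : Set β} (hX : IsOpen X)
    {f : α × β → γ} (hf : ContinuousOn f (s ×ˢ X)) (i : s) {y : β} (hy : y ∈ X) :
    ContinuousAt (fun p : s × β => f (p.1, p.2)) (i, y) := by
  refine Tendsto.comp (hf (i.1, y) ⟨i.2, hy⟩) (tendsto_nhdsWithin_iff.2 ⟨?_, ?_⟩)
  · exact Continuous.tendsto (f := fun p : s × β => (p.1.1, p.2)) (by fun_prop) (i, y)
  · filter_upwards [(continuous_snd.tendsto (i, y)).eventually (hX.eventually_mem hy)] with p hp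
    exact ⟨p.1.2, hp⟩

theorem continuousAt_sum_prod_inl {α α' β γ : Type*} [TopologicalSpace α] [TopologicalSpace α']
    [TopologicalSpace β] [TopologicalSpace γ] {f : (α ⊕ α') × β → γ} {a : α} {y : β}
    (hf : ContinuousAt (fun p : α × β => f (Sum.inl p.1, p.2)) (a, y)) :
    ContinuousAt f (Sum.inl a, y) :=
  ((IsOpenEmbedding.inl (Y := α')).prodMap (.id (X := β))).continuousAt_iff.1 hf

theorem continuousAt_sum_prod_inr {α α' β γ : Type*} [TopologicalSpace α] [TopologicalSpace α']
    [TopologicalSpace β] [TopologicalSpace γ] {f : (α ⊕ α') × β → γ} {a : α'} {y : β}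
    (hf : ContinuousAt (fun p : α' × β => f (Sum.inr p.1, p.2)) (a, y)) :
    ContinuousAt f (Sum.inr a, y) :=
  ((IsOpenEmbedding.inr (X := α)).prodMap (.id (X := β))).continuousAt_iff.1 hf

theorem IsNominalFlow.hasFDerivAt_comp (hX : IsOpen X) (hF : ContDiffOn ℝ 1 F X) (hT : 0 ≤ T)
    (hφ : IsNominalFlow X F T φ) (hh : ContDiffOn ℝ 1 h X) {x : Euc n} (hx : x ∈ X) {τ : ℝ}
    (hτ : τ ∈ Icc 0 T) : HasFDerivAt (fun y => h (φ τ y)) (gradAlong h φ τ x) x :=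
  (((hh.differentiableOn one_ne_zero).differentiableAt
    (hX.mem_nhds ((hφ x hx).2 τ hτ).1)).hasFDerivAt).comp x
      (hφ.differentiableAt hX hF hT hx hτ).hasFDerivAt

theorem IsNominalFlow.continuousOn_comp_uncurry (hX : IsOpen X) (hF : ContDiffOn ℝ 1 F X)
    (hT : 0 ≤ T) (hφ : IsNominalFlow X F T φ) (hh : ContDiffOn ℝ 1 h X) :
    ContinuousOn (fun p : ℝ × Euc n => h (φ p.1 p.2)) (Icc 0 T ×ˢ X) :=
  hh.continuousOn.comp (hφ.continuousOn_uncurry hX hF hT) fun p hp => ((hφ p.2 hp.2).2 _ hp.1).1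

theorem IsNominalFlow.continuousOn_gradAlong (hX : IsOpen X) (hF : ContDiffOn ℝ 1 F X) (hT : 0 ≤ T)
    (hφ : IsNominalFlow X F T φ) (hh : ContDiffOn ℝ 1 h X) :
    ContinuousOn (fun p : ℝ × Euc n => gradAlong h φ p.1 p.2) (Icc 0 T ×ˢ X) :=
  ((hh.continuousOn_fderiv_of_isOpen hX le_rfl).comp (hφ.continuousOn_uncurry hX hF hT)
    fun p hp => ((hφ p.2 hp.2).2 _ hp.1).1).clm_comp (hφ.continuousOn_sensitivity hX hF hT)

/-- Evaluation is a bounded bilinear map, hence smooth and locally Lipschitz; it is composed with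
the pair `(g, k)`. -/
theorem LocallyLipschitzOn.clm_apply {α E G : Type*} [PseudoEMetricSpace α] [NormedAddCommGroup E]
    [NormedSpace ℝ E] [NormedAddCommGroup G] [NormedSpace ℝ G] {s : Set α} {g : α → E →L[ℝ] G}
    {k : α → E} (hg : LocallyLipschitzOn s g) (hk : LocallyLipschitzOn s k) :
    LocallyLipschitzOn s fun x => g x (k x) := by
  intro x hx
  obtain ⟨K₁, t₁, ht₁, hgt⟩ := hg hx
  obtain ⟨K₂, t₂, ht₂, hkt⟩ := hk hx
  have happly : LocallyLipschitz fun p : (E →L[ℝ] G) × E => p.1 p.2 :=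
    (isBoundedBilinearMap_apply (𝕜 := ℝ) (E := E) (F := G)).contDiff.locallyLipschitz
  obtain ⟨K, u, hu, hau⟩ := happly (g x, k x)
  have hpre : (fun y => (g y, k y)) ⁻¹' u ∈ 𝓝[s] x :=
    ((hg.continuousOn x hx).prodMk (hk.continuousOn x hx)).preimage_mem_nhdsWithin hu
  have hpair : LipschitzOnWith (max K₁ K₂) (fun y => (g y, k y))
      (t₁ ∩ t₂ ∩ (fun y => (g y, k y)) ⁻¹' u) :=
    (hgt.mono fun y hy => hy.1.1).prodMk (hkt.mono fun y hy => hy.1.2)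
  exact ⟨K * max K₁ K₂, _, inter_mem (inter_mem ht₁ ht₂) hpre, hau.comp hpair fun y hy => hy.2⟩

theorem locallyLipschitzOn_closedLoop {m : ℕ} {f : Euc n → Euc n}
    {g : Euc n → (Euc m →L[ℝ] Euc n)} {k : Euc n → Euc m} (hf : LocallyLipschitzOn X f)
    (hg : LocallyLipschitzOn X g) (hk : LocallyLipschitzOn X k) :
    LocallyLipschitzOn X (closedLoop f g k) :=
  hf.add (hg.clm_apply hk)

end ConstraintRegularity

/-! ### Inclusions and invariance for the tightened set. -/

section TightenedSet

variable {n : ℕ} {X : Set (Euc n)} {F : Euc n → Euc n} {T : ℝ} {φn φd : ℝ → Euc n → Euc n}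
  {h hb : Euc n → ℝ}

/-- If the deviation of two flows is bounded by `δ`, tightening by the Lipschitz constant times `δ`
along the first flow enforces the constraints along the second one. -/
theorem tightenedSet_subset_disturbedSet {d : ℝ → Euc n} {Lh Lhb : NNReal}
    (hLh : LipschitzOnWith Lh h X) (hLhb : LipschitzOnWith Lhb hb X) (hT : 0 ≤ T)
    (hφn : IsNominalFlow X F T φn) (hφd : IsDisturbedFlow X F d T φd)
    {δ ε : ℝ → ℝ} {εb : ℝ} (hδ : ∀ τ ∈ Icc 0 T, 0 ≤ δ τ)
    (hdev : ∀ x ∈ safeSet X h, ∀ τ ∈ Icc 0 T, ‖φn τ x - φd τ x‖ ≤ δ τ)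
    (hε : ∀ τ ∈ Icc 0 T, Lh * δ τ ≤ ε τ) (hεb : Lhb * δ T ≤ εb) :
    tightenedSet X h hb T ε εb φn ⊆ disturbedSet X h hb T φd := by
  rintro x ⟨hx, hxh, hxb⟩
  have h0 : (0 : ℝ) ∈ Icc 0 T := ⟨le_rfl, hT⟩
  have hTm : T ∈ Icc 0 T := ⟨hT, le_rfl⟩
  -- The deviation bound is available only from safe initial states; safety of `x` is the constraint
  -- at `τ = 0`.
  have hsafe : x ∈ safeSet X h := by
    refine ⟨hx, ?_⟩
    have h1 := hxh 0 h0
    rw [(hφn x hx).1] at h1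
    exact (mul_nonneg Lh.2 (hδ 0 h0)).trans ((hε 0 h0).trans h1)
  have key : ∀ {q : Euc n → ℝ} {K : NNReal} {e τ : ℝ}, LipschitzOnWith K q X → τ ∈ Icc 0 T →
      K * δ τ ≤ e → e ≤ q (φn τ x) → 0 ≤ q (φd τ x) := by
    intro q K e τ hq hτ he hqe
    have h1 := hq.dist_le_mul _ ((hφn x hx).2 τ hτ).1 _ ((hφd x hx).2.2.1 τ hτ)
    rw [Real.dist_eq, dist_eq_norm] at h1
    have h2 := mul_le_mul_of_nonneg_left (hdev x hsafe τ hτ) K.2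
    have h3 := (abs_le.1 h1).2
    change (K : ℝ) * _ ≤ (K : ℝ) * _ at h2
    linarith
  exact ⟨hx, fun τ hτ => key hLh hτ (hε τ hτ) (hxh τ hτ), key hLhb hTm hεb hxb⟩

theorem disturbedSet_subset_safeSet {d : ℝ → Euc n} (hT : 0 ≤ T)
    (hφd : IsDisturbedFlow X F d T φd) : disturbedSet X h hb T φd ⊆ safeSet X h := by
  rintro x ⟨hx, hxh, -⟩
  have := hxh 0 ⟨le_rfl, hT⟩
  rw [(hφd x hx).1] at this
  exact ⟨hx, this⟩

/-- Forward invariance of the tightened set under a controller satisfying the robustified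
constraints. -/
theorem isForwardInvariantAlong_tightenedSet (hX : IsOpen X) (hF : ContDiffOn ℝ 1 F X) (hT : 0 ≤ T)
    (hφ : IsNominalFlow X F T φn) (hh : ContDiffOn ℝ 1 h X) (hhb : ContDiffOn ℝ 1 hb X)
    {ε : ℝ → ℝ} {εb : ℝ} (hεc : ContinuousOn ε (Icc 0 T))
    (hreg : ∀ x ∈ tightenedSet X h hb T ε εb φn, x ∈ frontier (tightenedSet X h hb T ε εb φn) →
      (∀ τ ∈ Icc 0 T, h (φn τ x) = ε τ → gradAlong h φn τ x ≠ 0) ∧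
      (hb (φn T x) = εb → gradAlong hb φn T x ≠ 0))
    {α αb : ℝ → ℝ} (hα : α 0 = 0) (hαb : αb 0 = 0) {ξ : ℝ} (hξ : 0 < ξ)
    {F' : Euc n → Euc n} (hF' : LocallyLipschitzOn X F')
    (hcon : ∀ x ∈ tightenedSet X h hb T ε εb φn,
      (∀ τ ∈ Icc 0 T,
        gradAlong h φn τ x (F' x) - ξ * ‖gradAlong h φn τ x‖ ≥ -α (h (φn τ x) - ε τ)) ∧
      gradAlong hb φn T x (F' x) - ξ * ‖gradAlong hb φn T x‖ ≥ -αb (hb (φn T x) - εb))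
    {d : ℝ → Euc n} (hd : ∀ t, 0 ≤ t → ‖d t‖ ≤ ξ) :
    IsForwardInvariantAlong X (disturbed F' d) (tightenedSet X h hb T ε εb φn) := by
  have hTm : T ∈ Icc 0 T := ⟨hT, le_rfl⟩
  -- The terminal constraint enters as an isolated point added to `[0,T]`, which keeps the index
  -- space compact.
  refine isForwardInvariantAlong_of_robust_constraints (ι := Icc (0 : ℝ) T ⊕ Unit)
    (H := Sum.elim (fun τ y => h (φn τ y) - ε τ) fun _ y => hb (φn T y) - εb)
    (G := Sum.elim (fun τ y => gradAlong h φn τ y) fun _ y => gradAlong hb φn T y)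
    hX ?_ ?_ ?_ ?_ ?_ hF' hξ ?_ hd
  · rintro (τ | u) y hy
    · refine continuousAt_sum_prod_inl ?_
      exact ContinuousOn.continuousAt_subtype_prod hX
        (f := fun p : ℝ × Euc n => h (φn p.1 p.2) - ε p.1)
        ((hφ.continuousOn_comp_uncurry hX hF hT hh).sub
          (hεc.comp continuousOn_fst fun p hp => hp.1)) τ hy
    · refine continuousAt_sum_prod_inr ?_
      have h1 : ContinuousAt (fun y => hb (φn T y)) y :=
        (hφ.hasFDerivAt_comp hX hF hT hhb hy hTm).continuousAt
      exact (h1.sub continuousAt_const).comp (f := fun p : Unit × Euc n => p.2) (x := (u, y))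
        (g := fun y => hb (φn T y) - εb) continuousAt_snd
  · rintro (τ | u) y hy
    · exact (hφ.hasFDerivAt_comp hX hF hT hh hy τ.2).sub_const _
    · exact (hφ.hasFDerivAt_comp hX hF hT hhb hy hTm).sub_const _
  · rintro (τ | u) y hy
    · refine continuousAt_sum_prod_inl ?_
      exact ContinuousOn.continuousAt_subtype_prod hX (hφ.continuousOn_gradAlong hX hF hT hh) τ hy
    · refine continuousAt_sum_prod_inr ?_
      have h1 := ContinuousOn.continuousAt_subtype_prod hX
        (hφ.continuousOn_gradAlong hX hF hT hhb) ⟨T, hTm⟩ hy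
      exact h1.comp (f := fun p : Unit × Euc n => ((⟨T, hTm⟩ : Icc (0 : ℝ) T), p.2)) (x := (u, y))
        (by fun_prop)
  · intro y
    simp [tightenedSet, Sum.forall]
    tauto
  · rintro y hy hyf (τ | u) hi
    · exact (hreg y hy hyf).1 τ τ.2 (sub_eq_zero.1 hi)
    · exact (hreg y hy hyf).2 (sub_eq_zero.1 hi)
  · rintro y hy (τ | u) hi
    · have := (hcon y hy).1 τ τ.2
      simp only [Sum.elim_inl] at hi ⊢
      rw [hi, hα] at this
      linarith
    · have := (hcon y hy).2
      simp only [Sum.elim_inr] at hi ⊢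
      rw [hi, hαb] at this
      linarith

end TightenedSet

/-! ### The main theorem. -/

theorem theorem3 {n m : ℕ}
    -- the system on the open state space `X`, with admissible inputs `U`
    (X : Set (Euc n)) (hX : IsOpen X) (U : Set (Euc m))
    (f : Euc n → Euc n) (g : Euc n → (Euc m →L[ℝ] Euc n))
    (hf : LocallyLipschitzOn X f) (hg : LocallyLipschitzOn X g)
    -- the constraint functions and their Lipschitz constants
    (h hb : Euc n → ℝ) (hh : ContDiffOn ℝ 1 h X) (hhb : ContDiffOn ℝ 1 hb X)
    (Lh Lhb : NNReal) (hLh : LipschitzOnWith Lh h X) (hLhb : LipschitzOnWith Lhb hb X)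
    -- the backup controller and its nominal flow
    (T : ℝ) (hT : 0 < T) (ub : Euc n → Euc m) (hub : ∀ x ∈ X, ub x ∈ U)
    (hcl : ContDiffOn ℝ 1 (closedLoop f g ub) X)
    (φn : ℝ → Euc n → Euc n) (hφn : IsNominalFlow X (closedLoop f g ub) T φn)
    -- the disturbance and the disturbed backup flow
    (ξ : ℝ) (hξ : 0 < ξ) (d : ℝ → Euc n) (hd : IsDisturbance ξ d)
    (φd : ℝ → Euc n → Euc n) (hφd : IsDisturbedFlow X (closedLoop f g ub) d T φd)
    -- the bound on the deviation of the two flows and the tightening terms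
    (δmax : ℝ → ℝ) (hδ : ∀ τ ∈ Icc 0 T, 0 ≤ δmax τ)
    (hdev : ∀ x ∈ safeSet X h, ∀ τ ∈ Icc 0 T, ‖φn τ x - φd τ x‖ ≤ δmax τ)
    (ε : ℝ → ℝ) (εb : ℝ) (hεc : ContinuousOn ε (Icc 0 T))
    (hε : ∀ τ ∈ Icc 0 T, Lh * δmax τ ≤ ε τ) (hεb : Lhb * δmax T ≤ εb)
    -- the functions defining `C_I` have nonzero gradient where they are active on its boundary
    (hreg : ∀ x ∈ tightenedSet X h hb T ε εb φn, x ∈ frontier (tightenedSet X h hb T ε εb φn) →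
      (∀ τ ∈ Icc 0 T, h (φn τ x) = ε τ → gradAlong h φn τ x ≠ 0) ∧
      (hb (φn T x) = εb → gradAlong hb φn T x ≠ 0))
    -- the controller, satisfying the robustified constraints on `C_I`
    (α αb : ℝ → ℝ) (hα : IsClassKInf α) (hαb : IsClassKInf αb)
    (k : Euc n → Euc m) (hkU : ∀ x ∈ X, k x ∈ U) (hk : LocallyLipschitzOn X k)
    (hcon : ∀ x ∈ tightenedSet X h hb T ε εb φn,
      (∀ τ ∈ Icc 0 T,
        gradAlong h φn τ x (f x + g x (k x)) - ξ * ‖gradAlong h φn τ x‖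
          ≥ -α (h (φn τ x) - ε τ)) ∧
      gradAlong hb φn T x (f x + g x (k x)) - ξ * ‖gradAlong hb φn T x‖
          ≥ -αb (hb (φn T x) - εb)) :
    IsForwardInvariantAlong X (disturbed (closedLoop f g k) d) (tightenedSet X h hb T ε εb φn) ∧
    tightenedSet X h hb T ε εb φn ⊆ disturbedSet X h hb T φd ∧
    disturbedSet X h hb T φd ⊆ safeSet X h ∧
    (∀ S : ℝ, 0 < S → ∀ x : ℝ → Euc n, IsSolution X (disturbed (closedLoop f g k) d) S x →
      x 0 ∈ tightenedSet X h hb T ε εb φn → ∀ t ∈ Icc 0 S, x t ∈ safeSet X h) := by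
  have hinv : IsForwardInvariantAlong X (disturbed (closedLoop f g k) d)
      (tightenedSet X h hb T ε εb φn) :=
    isForwardInvariantAlong_tightenedSet hX hcl hT.le hφn hh hhb hεc hreg hα.2.2.1 hαb.2.2.1 hξ
      (locallyLipschitzOn_closedLoop hf hg hk) hcon hd.2
  have hID : tightenedSet X h hb T ε εb φn ⊆ disturbedSet X h hb T φd :=
    tightenedSet_subset_disturbedSet hLh hLhb hT.le hφn hφd hδ hdev hε hεb
  have hDS : disturbedSet X h hb T φd ⊆ safeSet X h := disturbedSet_subset_safeSet hT.le hφd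
  exact ⟨hinv, hID, hDS, fun S hS x hx hx0 t ht => hDS (hID (hinv S hS x hx hx0 t ht))⟩
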